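/- For every $n$ there is a constant $C>0$, depending only on $n$, with the following property. Let $\mu=\sum_{\lambda\in\Lambda}\mu(\lambda)\delta_\lambda$ ($\mu(\lambda)\neq0$) be a pure point complex measure on $\mathbb R^n$ which is slowly increasing, i.e. $|\mu|(\{|x|<R\})=O(R^N)$ as $R\to\infty$ for some $N$. Assume that: 1. $\mu$ is positive-definite, i.e. its Fourier transform $\widehat\mu$ as a tempered distribution ($\langle\widehat\mu,\varphi\rangle=\langle\mu,\widehat\varphi\rangle$, $\widehat\varphi(t)=\int\varphi(x)e^{-2\pi i\langle t,x\rangle}dx$) satisfies $\langle\widehat\mu,\varphi\rangle\ge0$ for every Schwartz function $\varphi\ge0$; 2. $\widehat\mu$ is also a slowly increasing pure point measure, $\widehat\mu=\sum_{s\in S}\widehat\mu(s)\delta_s$ with $\widehat\mu(s)\neq0$ (here $S$ is countable and need not be closed; it is called the spectrum of $\mu$); 3. $\Lambda$ (the support of $\mu$) is uniformly discrete, where a set $A\subset\mathbb R^n$ is called uniformly discrete if $d(A):=\inf_{a,a'\in A,\,a\ne a'}|a-a'|>0$ (with $\inf\emptyset=\infty$). Then either $S$ is also uniformly discrete, or $S$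 has a relatively dense set of accumulation points, i.e. there is $R>0$ such that every ball of radius $R$ in $\mathbb R^n$ contains an accumulation point of $S$. Moreover, if $S$ is not uniformly discrete, then every ball of radius $C/d(\Lambda)$ contains infinitely many points of $S$. -/

import Mathlib

open scoped FourierTransform SchwartzMap ENNReal NNReal ComplexOrder

/-- A slowly increasing pure point complex measure `∑ x, mass x • δ_x` on `ℝⁿ`, given by its atoms.
The total variation of the open ball `B_R` is the sum of the `‖mass x‖` over `x ∈ B_R`; it is
required to be finite and to grow at most polynomially as `R → ∞`. In particular, the measure
is locally finite and has at most countably many non-zero atoms. -/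
structure PurePointMeasure (n : ℕ) where
  /-- The mass of each one-point set. -/
  mass : EuclideanSpace ℝ (Fin n) → ℂ
  /-- The total variation of `B_R` is `O(R ^ N)` for some `N`. -/
  slowlyIncreasing : ∃ (N : ℕ) (C : ℝ≥0), ∀ R : ℝ, 1 ≤ R →
    ∑' x : Metric.ball (0 : EuclideanSpace ℝ (Fin n)) R, ‖mass x‖ₑ ≤ C * ENNReal.ofReal R ^ N

namespace PurePointMeasure

/-- The support of a pure point measure: the set of its non-zero atoms (not its closure). -/
def support {n : ℕ} (μ : PurePointMeasure n) : Set (EuclideanSpace ℝ (Fin n)) :=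
  {x | μ.mass x ≠ 0}

/-- A slowly increasing measure integrates some negative power of `1 + ‖x‖`. -/
theorem exists_summable {n : ℕ} (μ : PurePointMeasure n) : ∃ k : ℕ,
    Summable fun x => ‖μ.mass x‖ * ((1 + ‖x‖) ^ k)⁻¹ := by
  obtain ⟨N, C, h⟩ := μ.slowlyIncreasing
  refine ⟨N + 1, ?_⟩
  have key : ∀ x : EuclideanSpace ℝ (Fin n), ENNReal.ofReal (((1 + ‖x‖) ^ (N + 1))⁻¹) ≤
      ∑' j : ℕ, (Metric.ball (0 : EuclideanSpace ℝ (Fin n)) (2 ^ j)).indicator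
        (fun _ => (2 : ℝ≥0∞) ^ (N + 1) * (((2 : ℝ≥0∞) ^ j) ^ (N + 1))⁻¹) x := by
    intro x
    have hx : (1 : ℝ) ≤ 1 + ‖x‖ := by linarith [norm_nonneg x]
    obtain ⟨m, hm1, hm2⟩ := exists_nat_pow_near hx one_lt_two
    refine le_trans ?_ (ENNReal.le_tsum (m + 1))
    rw [Set.indicator_of_mem (by simp only [mem_ball_zero_iff]; linarith)]
    have h2 : (2 : ℝ≥0∞) ^ (N + 1) * (((2 : ℝ≥0∞) ^ (m + 1)) ^ (N + 1))⁻¹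
        = ENNReal.ofReal (((2 : ℝ) ^ m) ^ (N + 1))⁻¹ := by
      rw [ENNReal.ofReal_inv_of_pos (by positivity), ENNReal.ofReal_pow (by positivity),
        ENNReal.ofReal_pow (by positivity), ENNReal.ofReal_ofNat, pow_succ (2 : ℝ≥0∞) m, mul_pow,
        ENNReal.mul_inv (by simp) (by simp), mul_comm, mul_assoc,
        ENNReal.inv_mul_cancel (by simp) (by simp), mul_one]
    rw [h2]
    gcongr
  have hfin : ∑' x, ‖μ.mass x‖ₑ * ENNReal.ofReal (((1 + ‖x‖) ^ (N + 1))⁻¹) ≠ ∞ := by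
    refine ne_top_of_le_ne_top (b := ∑' j : ℕ, (2 : ℝ≥0∞) ^ (N + 1) * C * 2⁻¹ ^ j) ?_ ?_
    · rw [ENNReal.tsum_mul_left, ENNReal.tsum_geometric]
      refine ENNReal.mul_ne_top (ENNReal.mul_ne_top (by simp) (by simp)) ?_
      simp
    · calc _ ≤ ∑' x, ‖μ.mass x‖ₑ * ∑' j : ℕ,
            (Metric.ball (0 : EuclideanSpace ℝ (Fin n)) (2 ^ j)).indicator
              (fun _ => (2 : ℝ≥0∞) ^ (N + 1) * (((2 : ℝ≥0∞) ^ j) ^ (N + 1))⁻¹) x := by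
            gcongr with x
            exact key x
        _ = ∑' j : ℕ, ((2 : ℝ≥0∞) ^ (N + 1) * (((2 : ℝ≥0∞) ^ j) ^ (N + 1))⁻¹) *
            ∑' x : Metric.ball (0 : EuclideanSpace ℝ (Fin n)) (2 ^ j), ‖μ.mass x‖ₑ := by
            simp_rw [← ENNReal.tsum_mul_left]
            rw [ENNReal.tsum_comm]
            refine tsum_congr fun j => ?_
            rw [tsum_subtype (Metric.ball (0 : EuclideanSpace ℝ (Fin n)) (2 ^ j))
              (fun x => (2 : ℝ≥0∞) ^ (N + 1) * (((2 : ℝ≥0∞) ^ j) ^ (N + 1))⁻¹ * ‖μ.mass x‖ₑ)]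
            refine tsum_congr fun x => ?_
            by_cases hx : x ∈ Metric.ball (0 : EuclideanSpace ℝ (Fin n)) (2 ^ j)
            · rw [Set.indicator_of_mem hx, Set.indicator_of_mem hx, mul_comm]
            · rw [Set.indicator_of_notMem hx, Set.indicator_of_notMem hx, mul_zero]
        _ ≤ _ := by
            refine ENNReal.tsum_le_tsum fun j => ?_
            have hj := h (2 ^ j) (one_le_pow₀ one_le_two)
            rw [ENNReal.ofReal_pow (by positivity), ENNReal.ofReal_ofNat] at hj
            refine (mul_le_mul_right hj _).trans (le_of_eq ?_)
            have h3 : (((2 : ℝ≥0∞) ^ j) ^ (N + 1))⁻¹ * ((2 : ℝ≥0∞) ^ j) ^ N = 2⁻¹ ^ j := by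
              rw [pow_succ, ENNReal.mul_inv (by simp) (by simp), mul_right_comm,
                ENNReal.inv_mul_cancel (by simp) (by simp), one_mul, ENNReal.inv_pow]
            rw [← h3]
            ring
  refine (ENNReal.summable_toReal hfin).congr fun x => ?_
  rw [ENNReal.toReal_mul, toReal_enorm, ENNReal.toReal_ofReal (by positivity)]

/-- The integral of a Schwartz function against a slowly increasing measure is bounded by one
Schwartz seminorm, and the series defining it converges absolutely. -/
theorem exists_bound {n : ℕ} (μ : PurePointMeasure n) : ∃ (k : ℕ) (C : ℝ), 0 ≤ C ∧
    ∀ φ : 𝓢(EuclideanSpace ℝ (Fin n), ℂ), (Summable fun x => ‖μ.mass x * φ x‖) ∧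
      ‖∑' x, μ.mass x * φ x‖ ≤ C * (Finset.Iic (k, 0)).sup
        (schwartzSeminormFamily ℂ (EuclideanSpace ℝ (Fin n)) ℂ) φ := by
  obtain ⟨k, hk⟩ := μ.exists_summable
  refine ⟨k, 2 ^ k * ∑' x, ‖μ.mass x‖ * ((1 + ‖x‖) ^ k)⁻¹, by positivity, fun φ => ?_⟩
  set s := (Finset.Iic (k, 0)).sup (schwartzSeminormFamily ℂ (EuclideanSpace ℝ (Fin n)) ℂ) φ
    with hs
  have hb : ∀ x, ‖μ.mass x * φ x‖ ≤ ‖μ.mass x‖ * ((1 + ‖x‖) ^ k)⁻¹ * (2 ^ k * s) := by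
    intro x
    have h1 : (1 + ‖x‖) ^ k * ‖φ x‖ ≤ 2 ^ k * s := by
      have h2 := SchwartzMap.one_add_le_sup_seminorm_apply (𝕜 := ℂ) (m := (k, 0)) (k := k)
        (n := 0) le_rfl le_rfl φ x
      rw [norm_iteratedFDeriv_zero] at h2
      exact h2
    have h0 : (0 : ℝ) < (1 + ‖x‖) ^ k := by positivity
    rw [norm_mul, mul_assoc]
    gcongr
    rw [← div_eq_inv_mul, le_div_iff₀' h0]
    exact h1
  have hsum : Summable fun x => ‖μ.mass x * φ x‖ :=
    (hk.mul_right (2 ^ k * s)).of_nonneg_of_le (fun x => norm_nonneg _) hb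
  refine ⟨hsum, (norm_tsum_le_tsum_norm hsum).trans ?_⟩
  refine (hsum.tsum_le_tsum hb (hk.mul_right _)).trans (le_of_eq ?_)
  rw [tsum_mul_right]
  ring

/-- The tempered distribution `φ ↦ ∫ φ dμ = ∑ x, mass x * φ x` defined by a slowly increasing
pure point measure. -/
noncomputable def toTemperedDistribution {n : ℕ} (μ : PurePointMeasure n) :
    𝓢'(EuclideanSpace ℝ (Fin n), ℂ) :=
  ContinuousLinearMap.toPointwiseConvergenceCLM _ _ _ _ <|
    SchwartzMap.mkCLMtoNormedSpace (𝕜 := ℂ) (σ := RingHom.id ℂ)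
      (fun φ : 𝓢(EuclideanSpace ℝ (Fin n), ℂ) => ∑' x, μ.mass x * φ x)
      (fun φ ψ => by
        obtain ⟨_, _, _, h⟩ := μ.exists_bound
        simp only [add_apply, mul_add]
        exact (h φ).1.of_norm.tsum_add (h ψ).1.of_norm)
      (fun c φ => by
        simp only [smul_apply, smul_eq_mul, RingHom.id_apply, mul_left_comm _ c]
        exact tsum_mul_left)
      (by
        obtain ⟨k, C, hC, h⟩ := μ.exists_bound
        exact ⟨Finset.Iic (k, 0), C, hC, fun φ => (h φ).2⟩)

@[simp]
theorem toTemperedDistribution_apply {n : ℕ} (μ : PurePointMeasure n)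
    (φ : 𝓢(EuclideanSpace ℝ (Fin n), ℂ)) :
    μ.toTemperedDistribution φ = ∑' x, μ.mass x * φ x := rfl

end PurePointMeasure

/-- A tempered distribution is positive if it is non-negative on every Schwartz function `φ ≥ 0`.
(In the order on `ℂ`, `0 ≤ z` means that `z` is real and non-negative.) -/
def IsPositiveDistribution {n : ℕ} (α : 𝓢'(EuclideanSpace ℝ (Fin n), ℂ)) : Prop :=
  ∀ φ : 𝓢(EuclideanSpace ℝ (Fin n), ℂ), (∀ x, 0 ≤ φ x) → 0 ≤ α φ

/-- A tempered distribution is positive-definite if its Fourier transform is positive. -/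
def IsPositiveDefiniteDistribution {n : ℕ} (α : 𝓢'(EuclideanSpace ℝ (Fin n), ℂ)) : Prop :=
  IsPositiveDistribution (𝓕 α)

/-- A set is uniformly discrete if the infimum of the distances between its distinct points is
positive (the infimum being `∞` if there are no two distinct points). -/
def IsUniformlyDiscrete {n : ℕ} (A : Set (EuclideanSpace ℝ (Fin n))) : Prop :=
  0 < A.einfsep

/-- A set is relatively dense if, for some `R > 0`, it meets every ball of radius `R`. -/
def IsRelativelyDense {n : ℕ} (A : Set (EuclideanSpace ℝ (Fin n))) : Prop :=
  ∃ R : ℝ, 0 < R ∧ ∀ x, (Metric.ball x R ∩ A).Nonempty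

/-!
Let `ν ≥ 0` be the Fourier transform of `μ`, with spectrum `S`, and consider the correlation measure
`ν_h = ∑ s, ν {s} ν {s + h} δ_s`. The atom `ν {s + h}` is a limit of averages of `ν` over shrinking
neighbourhoods, and these averages are exponential sums in `s` with frequencies in the support `Λ`
of `μ`. If the Fourier transform of a test function `φ` vanishes outside the ball of radius `d(Λ)`,
twisting `φ` by such a frequency singles out one atom of `μ`; hence the convolution of `ν_h` with
`φ` is a constant, and this constant is proportional to `∫ φ`.

If `h` is a difference of two points of `S`, testing with some `φ ≥ 0` shows that the constants are
positive multiples of `∫ φ`. A `φ` of positive integral that is nonpositive outside a ball of radius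
`R / d(Λ)` then shows that every such ball contains a point `s` with `s, s + h ∈ S`. If `S` is not
uniformly discrete, arbitrarily small differences `h` thus recur in every ball, so that every
slightly larger ball contains infinitely many points of `S`.
-/

open MeasureTheory Filter Topology Metric

section Schwartz

variable {V F : Type*} [NormedAddCommGroup V] [InnerProductSpace ℝ V] [FiniteDimensional ℝ V]
  [MeasurableSpace V] [BorelSpace V] [NormedAddCommGroup F] [NormedSpace ℂ F]

theorem fourier_compSubConstCLM_apply (f : 𝓢(V, F)) (a w : V) :
    𝓕 (f.compSubConstCLM ℂ a) w = 𝐞 (-inner ℝ a w) • 𝓕 f w := by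
  have h := congrFun (VectorFourier.fourierIntegral_comp_add_right 𝐞 volume (innerₗ V) (⇑f) (-a)) w
  have hf : ⇑(f.compSubConstCLM ℂ a) = ⇑f ∘ fun v => v + -a := by
    ext v
    simp [sub_eq_add_neg]
  simp only [map_neg, LinearMap.neg_apply, innerₗ_apply_apply] at h
  rw [SchwartzMap.fourier_coe, SchwartzMap.fourier_coe, hf]
  exact h

theorem fourierInv_compSubConstCLM_apply (f : 𝓢(V, F)) (a w : V) :
    𝓕⁻ (f.compSubConstCLM ℂ a) w = 𝐞 (inner ℝ a w) • 𝓕⁻ f w := by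
  simp [SchwartzMap.fourierInv_apply_eq, fourier_compSubConstCLM_apply]

theorem fourier_fourier_apply [CompleteSpace F] (f : 𝓢(V, F)) (x : V) : 𝓕 (𝓕 f) x = f (-x) := by
  have h : 𝓕⁻ (𝓕 f) (-x) = f (-x) := by simp
  rw [← h, SchwartzMap.fourierInv_apply_eq]
  simp

theorem fourier_zero_eq_integral (f : 𝓢(V, F)) : 𝓕 f 0 = ∫ x, f x := by
  simp [SchwartzMap.fourier_coe, Real.fourier_eq]

theorem fourier_zero_nonneg {f : 𝓢(V, ℂ)} (hf : ∀ x, 0 ≤ f x) : 0 ≤ 𝓕 f 0 := by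
  rw [fourier_zero_eq_integral]
  exact integral_nonneg hf

theorem norm_fourier_le_integral_norm (f : 𝓢(V, F)) (w : V) : ‖𝓕 f w‖ ≤ ∫ v, ‖f v‖ :=
  VectorFourier.norm_fourierIntegral_le_integral_norm _ _ _ _ _

theorem fourier_fourierMultiplierCLM_norm_sq_apply [CompleteSpace F] (f : 𝓢(V, F)) (x : V) :
    𝓕 (SchwartzMap.fourierMultiplierCLM F (fun v : V => ‖v‖ ^ 2) f) x = ‖x‖ ^ 2 • 𝓕 f x := by
  rw [SchwartzMap.fourierMultiplierCLM_apply, FourierTransform.fourier_fourierInv_eq,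
    SchwartzMap.smulLeftCLM_apply_apply (by fun_prop)]

theorem fourierMultiplierCLM_norm_sq_apply_eq_zero [CompleteSpace F] {f : 𝓢(V, F)} {x : V}
    (hf : f =ᶠ[𝓝 x] fun _ => 0) :
    SchwartzMap.fourierMultiplierCLM F (fun v : V => ‖v‖ ^ 2) f x = 0 := by
  have hΔ : Laplacian.laplacian f x = 0 := by
    rw [SchwartzMap.laplacian_apply, (InnerProductSpace.laplacian_congr_nhds hf).eq_of_nhds]
    simp
  rw [SchwartzMap.laplacian_eq_fourierMultiplierCLM, smul_apply, smul_eq_zero] at hΔ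
  exact hΔ.resolve_left (by simp [Real.pi_ne_zero])

/-- The dilation `x ↦ f (c x)` of a Schwartz function by a nonzero scalar `c`, which scales the band
limit of `f` by `|c|`. -/
noncomputable def schwartzDilation (c : ℝˣ) (f : 𝓢(V, F)) : 𝓢(V, F) :=
  f.compCLMOfContinuousLinearEquiv ℂ (ContinuousLinearEquiv.smulLeft c)

omit [FiniteDimensional ℝ V] [MeasurableSpace V] [BorelSpace V] in
@[simp]
theorem schwartzDilation_apply (c : ℝˣ) (f : 𝓢(V, F)) (x : V) :
    schwartzDilation c f x = f (c • x) := rfl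

theorem fourier_schwartzDilation_apply (c : ℝˣ) (f : 𝓢(V, F)) (ξ : V) :
    𝓕 (schwartzDilation c f) ξ = |((c : ℝ) ^ Module.finrank ℝ V)⁻¹| • 𝓕 f (c⁻¹ • ξ) := by
  simp only [SchwartzMap.fourier_coe, Real.fourier_eq]
  rw [← Measure.integral_comp_smul volume (fun x : V => 𝐞 (-inner ℝ x (c⁻¹ • ξ)) • f x) (c : ℝ)]
  refine integral_congr_ae (.of_forall fun x => ?_)
  simp [Units.smul_def, inner_smul_left, inner_smul_right]

/-- A Schwartz function is band-limited to the ball of radius `d` if its Fourier transform vanishes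
outside the open ball of radius `d` around the origin. -/
def IsBandlimited (d : ℝ) (φ : 𝓢(V, F)) : Prop :=
  ∀ ξ, d ≤ ‖ξ‖ → 𝓕 φ ξ = 0

theorem IsBandlimited.schwartzDilation {d : ℝ} {φ : 𝓢(V, F)} (hφ : IsBandlimited d φ) (c : ℝˣ) :
    IsBandlimited (|(c : ℝ)| * d) (schwartzDilation c φ) := by
  intro ξ hξ
  rw [fourier_schwartzDilation_apply, hφ, smul_zero]
  rw [Units.smul_def, norm_smul, Units.val_inv_eq_inv_val, norm_inv, Real.norm_eq_abs]
  exact (le_inv_mul_iff₀ (abs_pos.mpr c.ne_zero)).mpr hξ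

end Schwartz

section Bump

variable {V : Type*} [NormedAddCommGroup V] [InnerProductSpace ℝ V] [FiniteDimensional ℝ V]

/-- A bump function centred at the origin, as a complex-valued Schwartz function. -/
noncomputable def schwartzBump (b : ContDiffBump (0 : V)) : 𝓢(V, ℂ) :=
  (b.hasCompactSupport.comp_left (g := ((↑) : ℝ → ℂ)) Complex.ofReal_zero).toSchwartzMap
    (Complex.ofRealCLM.contDiff.comp b.contDiff)

@[simp]
theorem schwartzBump_apply (b : ContDiffBump (0 : V)) (x : V) : schwartzBump b x = (b x : ℂ) := rfl

variable [MeasurableSpace V] [BorelSpace V]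

/-- The autocorrelation of a bump function centred at the origin; as the bump function is even, this
is its convolution with itself. -/
noncomputable def bumpAutocorrelation (b : ContDiffBump (0 : V)) : 𝓢(V, ℂ) :=
  SchwartzMap.convolution (ContinuousLinearMap.mul ℂ ℂ) (schwartzBump b) (schwartzBump b)

variable (b : ContDiffBump (0 : V))

theorem bumpAutocorrelation_apply (x : V) :
    bumpAutocorrelation b x = ((∫ t, b t * b (x - t) : ℝ) : ℂ) := by
  rw [bumpAutocorrelation, SchwartzMap.convolution_apply, ← integral_complex_ofReal]
  simp [convolution]

theorem bumpAutocorrelation_eq_zero {x : V} (hx : 2 * b.rOut ≤ ‖x‖) :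
    bumpAutocorrelation b x = 0 := by
  have hzero (t : V) : b t * b (x - t) = 0 := by
    rcases le_or_gt b.rOut ‖t‖ with ht | ht
    · rw [b.zero_of_le_dist (x := t) (by simpa using ht), zero_mul]
    · have := norm_sub_norm_le x t
      rw [b.zero_of_le_dist (x := x - t) (by rw [dist_zero_right]; linarith), mul_zero]
  simp [bumpAutocorrelation_apply, hzero]

theorem bumpAutocorrelation_zero_pos : 0 < bumpAutocorrelation b 0 := by
  simp only [bumpAutocorrelation_apply, zero_sub, b.neg, Complex.zero_lt_real]
  refine (b.continuous.mul b.continuous).integral_pos_of_hasCompactSupport_nonneg_nonzero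
    b.hasCompactSupport.mul_left (fun t => mul_self_nonneg (b t)) (x := 0) ?_
  simp [b.eventuallyEq_one.eq_of_nhds]

theorem conj_fourier_schwartzBump (x : V) :
    starRingEnd ℂ (𝓕 (schwartzBump b) x) = 𝓕 (schwartzBump b) x := by
  rw [SchwartzMap.fourier_coe, Real.fourier_eq, ← integral_conj, ← integral_neg_eq_self]
  congr! 2
  simp [Circle.smul_def, b.neg, ← Circle.coe_inv_eq_conj, ← AddChar.map_neg_eq_inv]

theorem fourier_bumpAutocorrelation (x : V) :
    𝓕 (bumpAutocorrelation b) x = 𝓕 (schwartzBump b) x * 𝓕 (schwartzBump b) x := by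
  simp [bumpAutocorrelation, SchwartzMap.fourier_convolution, SchwartzMap.pairing_apply_apply]

theorem fourier_bumpAutocorrelation_nonneg (x : V) : 0 ≤ 𝓕 (bumpAutocorrelation b) x := by
  nth_rw 1 [fourier_bumpAutocorrelation, ← conj_fourier_schwartzBump]
  exact star_mul_self_nonneg _

theorem fourier_bumpAutocorrelation_zero_pos : 0 < 𝓕 (bumpAutocorrelation b) 0 := by
  have hpos : 0 < 𝓕 (schwartzBump b) 0 := by
    simp only [fourier_zero_eq_integral, schwartzBump_apply, integral_complex_ofReal,
      Complex.zero_lt_real, b.integral_pos]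
  simpa only [fourier_bumpAutocorrelation] using mul_pos hpos hpos

theorem isBandlimited_fourier_bumpAutocorrelation :
    IsBandlimited (2 * b.rOut) (𝓕 (bumpAutocorrelation b)) := fun ξ hξ => by
  rw [fourier_fourier_apply, bumpAutocorrelation_eq_zero b (by rwa [norm_neg])]

variable (V) in
theorem exists_isBandlimited_nonneg {d : ℝ} (hd : 0 < d) :
    ∃ φ : 𝓢(V, ℂ), IsBandlimited d φ ∧ (∀ x, 0 ≤ φ x) ∧ 0 < φ 0 := by
  let b : ContDiffBump (0 : V) := ⟨d / 4, d / 2, by positivity, by linarith⟩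
  have hb : 2 * b.rOut = d := mul_div_cancel₀ d two_ne_zero
  exact ⟨𝓕 (bumpAutocorrelation b), hb ▸ isBandlimited_fourier_bumpAutocorrelation b,
    fourier_bumpAutocorrelation_nonneg b, fourier_bumpAutocorrelation_zero_pos b⟩

theorem fourierMultiplierCLM_norm_sq_bumpAutocorrelation_zero_nonneg :
    0 ≤ SchwartzMap.fourierMultiplierCLM ℂ (fun v : V => ‖v‖ ^ 2) (bumpAutocorrelation b) 0 := by
  rw [SchwartzMap.fourierMultiplierCLM_apply, SchwartzMap.fourierInv_coe, Real.fourierInv_eq]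
  refine integral_nonneg fun v => ?_
  rw [SchwartzMap.smulLeftCLM_apply_apply (by fun_prop)]
  simpa using smul_nonneg (sq_nonneg ‖v‖) (fourier_bumpAutocorrelation_nonneg b v)

theorem fourierMultiplierCLM_norm_sq_bumpAutocorrelation_eq_zero {x : V} (hx : 2 * b.rOut < ‖x‖) :
    SchwartzMap.fourierMultiplierCLM ℂ (fun v : V => ‖v‖ ^ 2) (bumpAutocorrelation b) x = 0 := by
  refine fourierMultiplierCLM_norm_sq_apply_eq_zero ?_
  filter_upwards [(isOpen_lt continuous_const continuous_norm).mem_nhds hx] with y hy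
  exact bumpAutocorrelation_eq_zero b (le_of_lt hy)

theorem exists_fourierMultiplierCLM_norm_sq_bumpAutocorrelation_zero_lt :
    ∃ R : ℝ, 0 < R ∧ SchwartzMap.fourierMultiplierCLM ℂ (fun v : V => ‖v‖ ^ 2)
      (bumpAutocorrelation b) 0 < R ^ 2 * bumpAutocorrelation b 0 := by
  obtain ⟨g, hg, hG⟩ := RCLike.pos_iff_exists_ofReal.mp (bumpAutocorrelation_zero_pos b)
  obtain ⟨m, -, hM⟩ := RCLike.nonneg_iff_exists_ofReal.mp
    (fourierMultiplierCLM_norm_sq_bumpAutocorrelation_zero_nonneg b)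
  obtain ⟨R, hR, hmR⟩ : ∃ R : ℝ, 0 < R ∧ m < R ^ 2 * g :=
    ((eventually_gt_atTop 0).and (((tendsto_pow_atTop two_ne_zero).atTop_mul_const
      hg).eventually_gt_atTop m)).exists
  refine ⟨R, hR, ?_⟩
  rw [← hG, ← hM]
  simp only [RCLike.ofReal_eq_complex_ofReal]
  exact_mod_cast hmR

variable (V) in
theorem exists_isBandlimited_one_nonpos_outside_ball :
    ∃ R : ℝ, 0 < R ∧ ∃ φ : 𝓢(V, ℂ), IsBandlimited 1 φ ∧ (∀ x, R ≤ ‖x‖ → φ x ≤ 0) ∧ 0 < 𝓕 φ 0 := by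
  let b : ContDiffBump (0 : V) := ⟨1 / 4, 1 / 3, by norm_num, by norm_num⟩
  let G := bumpAutocorrelation b
  let M := SchwartzMap.fourierMultiplierCLM ℂ (fun v : V => ‖v‖ ^ 2)
  obtain ⟨R, hR, hlt⟩ := exists_fourierMultiplierCLM_norm_sq_bumpAutocorrelation_zero_lt b
  -- `𝓕 W` is `(R² - ‖x‖²) 𝓕 G` with `𝓕 G ≥ 0`, and its integral is `W 0`, positive for large `R`.
  let W : 𝓢(V, ℂ) := (R ^ 2 : ℂ) • G - M G
  refine ⟨R, hR, 𝓕 W, fun ξ hξ => ?_, fun x hx => ?_, ?_⟩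
  · have hb : 2 * b.rOut < ‖-ξ‖ := by
      rw [norm_neg]
      exact lt_of_lt_of_le (by norm_num [b]) hξ
    have hG : G (-ξ) = 0 := bumpAutocorrelation_eq_zero b hb.le
    have hM : M G (-ξ) = 0 := fourierMultiplierCLM_norm_sq_bumpAutocorrelation_eq_zero b hb
    simp [fourier_fourier_apply, W, hG, hM]
  · have hW : 𝓕 W x = ((R ^ 2 - ‖x‖ ^ 2 : ℝ) : ℂ) * 𝓕 G x := by
      have hM : 𝓕 (M G) x = ‖x‖ ^ 2 • 𝓕 G x := fourier_fourierMultiplierCLM_norm_sq_apply G x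
      simp only [W, sub_eq_add_neg, FourierTransform.fourier_add, FourierTransform.fourier_neg,
        FourierTransform.fourier_smul, add_apply, neg_apply, smul_apply, smul_eq_mul, hM,
        Complex.real_smul]
      push_cast
      ring
    rw [hW]
    refine mul_nonpos_of_nonpos_of_nonneg ?_ (fourier_bumpAutocorrelation_nonneg b x)
    exact_mod_cast sub_nonpos.mpr (pow_le_pow_left₀ hR.le hx 2)
  · rw [fourier_fourier_apply, neg_zero]
    exact sub_pos.mpr hlt

variable (V) in
theorem exists_isBandlimited_nonpos_outside_ball :
    ∃ R : ℝ, 0 < R ∧ ∀ d : ℝ, 0 < d → ∃ φ : 𝓢(V, ℂ),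
      IsBandlimited d φ ∧ (∀ x, R / d ≤ ‖x‖ → φ x ≤ 0) ∧ 0 < 𝓕 φ 0 := by
  obtain ⟨R, hR, φ, hband, hneg, hpos⟩ := exists_isBandlimited_one_nonpos_outside_ball V
  refine ⟨R, hR, fun d hd => ?_⟩
  let c := Units.mk0 d hd.ne'
  refine ⟨schwartzDilation c φ, ?_, fun x hx => ?_, ?_⟩
  · simpa [c, abs_of_pos hd] using hband.schwartzDilation c
  · refine hneg _ ?_
    simpa [c, Units.smul_mk0, norm_smul, abs_of_pos hd] using (div_le_iff₀' hd).mp hx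
  · rw [fourier_schwartzDilation_apply, smul_zero]
    exact smul_pos (by simp [hd.ne', c]) hpos

end Bump

section ShrinkingBump

variable (V : Type*) [NormedAddCommGroup V] [InnerProductSpace ℝ V] [FiniteDimensional ℝ V]

/-- A decreasing sequence of bump functions equal to `1` at the origin, whose supports shrink to the
origin: the `k`-th one is equal to `1` on the support of the next. -/
noncomputable def shrinkingBump (k : ℕ) : 𝓢(V, ℂ) :=
  schwartzBump ⟨1 / (k + 2), 1 / (k + 1), by positivity, by gcongr; norm_num⟩

variable {V}

theorem shrinkingBump_nonneg (k : ℕ) (x : V) : 0 ≤ shrinkingBump V k x :=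
  Complex.zero_le_real.mpr (ContDiffBump.nonneg _)

theorem norm_shrinkingBump_le_one (k : ℕ) (x : V) : ‖shrinkingBump V k x‖ ≤ 1 := by
  rw [shrinkingBump, schwartzBump_apply, Complex.norm_of_nonneg (ContDiffBump.nonneg _)]
  exact ContDiffBump.le_one _

theorem shrinkingBump_eq_one {k : ℕ} {x : V} (hx : ‖x‖ ≤ 1 / (k + 2)) :
    shrinkingBump V k x = 1 := by
  rw [shrinkingBump, schwartzBump_apply,
    ContDiffBump.one_of_mem_closedBall _ (mem_closedBall_zero_iff.mpr hx), Complex.ofReal_one]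

theorem shrinkingBump_eq_zero {k : ℕ} {x : V} (hx : 1 / (k + 1) ≤ ‖x‖) :
    shrinkingBump V k x = 0 := by
  rw [shrinkingBump, schwartzBump_apply,
    ContDiffBump.zero_of_le_dist _ ((dist_zero_right x).symm ▸ hx), Complex.ofReal_zero]

@[simp]
theorem shrinkingBump_zero (k : ℕ) : shrinkingBump V k 0 = 1 :=
  shrinkingBump_eq_one (by rw [norm_zero]; positivity)

theorem antitone_norm_shrinkingBump (x : V) : Antitone fun k => ‖shrinkingBump V k x‖ := by
  refine antitone_nat_of_succ_le fun k => ?_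
  rcases le_total ‖x‖ (1 / (k + 2)) with hx | hx
  · rw [shrinkingBump_eq_one hx, norm_one]
    exact norm_shrinkingBump_le_one _ x
  · have hk : ((k + 1 : ℕ) : ℝ) + 1 = k + 2 := by push_cast; ring
    rw [shrinkingBump_eq_zero (by rwa [hk]), norm_zero]
    exact norm_nonneg _

theorem eventually_shrinkingBump_eq_zero {x : V} (hx : x ≠ 0) :
    ∀ᶠ k in atTop, shrinkingBump V k x = 0 := by
  filter_upwards [tendsto_one_div_add_atTop_nhds_zero_nat.eventually_le_const
    (norm_pos_iff.mpr hx)] with k hk using shrinkingBump_eq_zero hk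

theorem tendsto_integral_norm_shrinkingBump [MeasurableSpace V] [BorelSpace V] [Nontrivial V] :
    Tendsto (fun k => ∫ x : V, ‖shrinkingBump V k x‖) atTop (𝓝 0) := by
  rw [← integral_zero V ℝ (μ := volume)]
  refine tendsto_integral_of_dominated_convergence (fun x => ‖shrinkingBump V 0 x‖)
    (fun k => (SchwartzMap.continuous _).norm.aestronglyMeasurable)
    (SchwartzMap.integrable _).norm (fun k => .of_forall fun x => ?_) ?_
  · rw [norm_norm]
    exact antitone_norm_shrinkingBump x k.zero_le
  · filter_upwards [Measure.ae_ne volume 0] with x hx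
    refine tendsto_const_nhds.congr' ?_
    filter_upwards [eventually_shrinkingBump_eq_zero hx] with k hk
    rw [hk, norm_zero]

end ShrinkingBump

theorem norm_tsum_le_norm_tsum_of_nonneg {ι : Type*} {f g : ι → ℂ} (hg : ∀ i, 0 ≤ g i)
    (hsum : Summable g) (hfg : ∀ i, ‖f i‖ ≤ ‖g i‖) : ‖∑' i, f i‖ ≤ ‖∑' i, g i‖ := by
  have hnorm : HasSum (fun i => ‖g i‖) ‖∑' i, g i‖ := by
    rw [← Complex.hasSum_ofReal, ← Complex.eq_coe_norm_of_nonneg (tsum_nonneg hg)]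
    simpa only [← Complex.eq_coe_norm_of_nonneg (hg _)] using hsum.hasSum
  exact tsum_of_norm_bounded hnorm hfg

namespace PurePointMeasure

variable {n : ℕ} {μ ν : PurePointMeasure n}

theorem mass_eq_zero_of_notMem_support {x : EuclideanSpace ℝ (Fin n)} (hx : x ∉ μ.support) :
    μ.mass x = 0 :=
  not_not.mp hx

theorem summable_mass_mul (μ : PurePointMeasure n) (φ : 𝓢(EuclideanSpace ℝ (Fin n), ℂ)) :
    Summable fun x => μ.mass x * φ x := by
  obtain ⟨_, _, _, h⟩ := μ.exists_bound
  exact (h φ).1.of_norm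

theorem summable_mass_mul_comp_sub (μ : PurePointMeasure n)
    (φ : 𝓢(EuclideanSpace ℝ (Fin n), ℂ)) (y : EuclideanSpace ℝ (Fin n)) :
    Summable fun x => μ.mass x * φ (x - y) :=
  μ.summable_mass_mul (φ.compSubConstCLM ℂ y)

/-- The integral of the translate to `y` of the `k`-th bump function. These averages approximate the
atom at `y`, and they are exponential sums as functions of `y` if `ν` has a pure point Fourier
transform. -/
noncomputable def bumpAverage (ν : PurePointMeasure n) (k : ℕ) (y : EuclideanSpace ℝ (Fin n)) : ℂ :=
  ∑' s, ν.mass s * shrinkingBump _ k (s - y)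

theorem norm_mass_mul_shrinkingBump_le (ν : PurePointMeasure n) (k : ℕ)
    (s y : EuclideanSpace ℝ (Fin n)) :
    ‖ν.mass s * shrinkingBump _ k (s - y)‖ ≤ ‖ν.mass s * shrinkingBump _ 0 (s - y)‖ := by
  rw [norm_mul, norm_mul]
  exact mul_le_mul_of_nonneg_left (antitone_norm_shrinkingBump _ k.zero_le) (norm_nonneg _)

theorem tendsto_bumpAverage (ν : PurePointMeasure n) (y : EuclideanSpace ℝ (Fin n)) :
    Tendsto (fun k => ν.bumpAverage k y) atTop (𝓝 (ν.mass y)) := by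
  have hsum : ∑' s, (if s = y then ν.mass y else 0) = ν.mass y := tsum_ite_eq y fun _ => ν.mass y
  rw [← hsum]
  refine tendsto_tsum_of_dominated_convergence (ν.summable_mass_mul_comp_sub _ y).norm
    (fun s => ?_) (.of_forall fun k s => ν.norm_mass_mul_shrinkingBump_le k s y)
  by_cases hs : s = y
  · simp [hs]
  · refine tendsto_const_nhds.congr' ?_
    filter_upwards [eventually_shrinkingBump_eq_zero (sub_ne_zero.mpr hs)] with k hk
    simp [hk, hs]

theorem mass_nonneg_of_isPositive (hν : IsPositiveDistribution ν.toTemperedDistribution)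
    (x : EuclideanSpace ℝ (Fin n)) : 0 ≤ ν.mass x :=
  ge_of_tendsto' (ν.tendsto_bumpAverage x) fun k =>
    hν ((shrinkingBump _ k).compSubConstCLM ℂ x) fun s => shrinkingBump_nonneg k (s - x)

theorem tsum_mass_mul_eq_tsum_mass_mul_fourier
    (hF : 𝓕 μ.toTemperedDistribution = ν.toTemperedDistribution)
    (φ : 𝓢(EuclideanSpace ℝ (Fin n), ℂ)) :
    ∑' s, ν.mass s * φ s = ∑' l, μ.mass l * 𝓕 φ l := by
  rw [← toTemperedDistribution_apply, ← hF, TemperedDistribution.fourier_apply,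
    toTemperedDistribution_apply]

theorem tsum_mass_mul_comp_sub
    (hF : 𝓕 μ.toTemperedDistribution = ν.toTemperedDistribution)
    (φ : 𝓢(EuclideanSpace ℝ (Fin n), ℂ)) (y : EuclideanSpace ℝ (Fin n)) :
    ∑' s, ν.mass s * φ (s - y) = ∑' l, μ.mass l * (𝐞 (-inner ℝ y l) * 𝓕 φ l) := by
  simpa only [SchwartzMap.compSubConstCLM_apply, fourier_compSubConstCLM_apply, Circle.smul_def,
    smul_eq_mul] using tsum_mass_mul_eq_tsum_mass_mul_fourier hF (φ.compSubConstCLM ℂ y)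

theorem exists_norm_bumpAverage_le
    (hF : 𝓕 μ.toTemperedDistribution = ν.toTemperedDistribution) (hν : ∀ s, 0 ≤ ν.mass s) :
    ∃ M, ∀ k y, ‖ν.bumpAverage k y‖ ≤ M := by
  let β := shrinkingBump (EuclideanSpace ℝ (Fin n)) 0
  refine ⟨∑' l, ‖μ.mass l * 𝓕 β l‖, fun k y => ?_⟩
  calc ‖ν.bumpAverage k y‖
    _ ≤ ‖∑' s, ν.mass s * β (s - y)‖ :=
        norm_tsum_le_norm_tsum_of_nonneg (fun s => mul_nonneg (hν s) (shrinkingBump_nonneg _ _))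
          (ν.summable_mass_mul_comp_sub β y) fun s => ν.norm_mass_mul_shrinkingBump_le k s y
    _ = ‖∑' l, μ.mass l * (𝐞 (-inner ℝ y l) * 𝓕 β l)‖ := by rw [tsum_mass_mul_comp_sub hF]
    _ ≤ ∑' l, ‖μ.mass l * 𝓕 β l‖ :=
        tsum_of_norm_bounded (μ.summable_mass_mul (𝓕 β)).norm.hasSum fun l => by
          simp only [norm_mul, Circle.norm_coe, one_mul, le_refl]

theorem mass_eq_zero_of_summable (hF : 𝓕 μ.toTemperedDistribution = ν.toTemperedDistribution)
    [Nontrivial (EuclideanSpace ℝ (Fin n))] (hμ : Summable fun l => ‖μ.mass l‖)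
    (x : EuclideanSpace ℝ (Fin n)) : ν.mass x = 0 := by
  refine tendsto_nhds_unique (ν.tendsto_bumpAverage x) (squeeze_zero_norm (fun k => ?_)
    (by simpa using (tendsto_integral_norm_shrinkingBump
      (V := EuclideanSpace ℝ (Fin n))).const_mul (∑' l, ‖μ.mass l‖)))
  rw [bumpAverage, tsum_mass_mul_comp_sub hF]
  refine tsum_of_norm_bounded (hμ.hasSum.mul_right _) fun l => ?_
  rw [norm_mul, norm_mul, Circle.norm_coe, one_mul]
  exact mul_le_mul_of_nonneg_left (norm_fourier_le_integral_norm _ l) (norm_nonneg _)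

theorem nontrivial_support_of_nontrivial_support
    (hF : 𝓕 μ.toTemperedDistribution = ν.toTemperedDistribution) (hν : ν.support.Nontrivial) :
    μ.support.Nontrivial := by
  obtain ⟨a, ha, b, -, hab⟩ := hν
  have : Nontrivial (EuclideanSpace ℝ (Fin n)) := ⟨a, b, hab⟩
  refine Set.not_subsingleton_iff.mp fun hμ => ha (mass_eq_zero_of_summable hF ?_ a)
  exact summable_of_hasFiniteSupport (hμ.finite.subset fun l => norm_ne_zero_iff.mp)

theorem tsum_mass_mul_fourierChar (hF : 𝓕 μ.toTemperedDistribution = ν.toTemperedDistribution)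
    {d : ℝ} (hsep : μ.support.Pairwise fun l l' => d ≤ dist l l')
    {φ : 𝓢(EuclideanSpace ℝ (Fin n), ℂ)} (hφ : IsBandlimited d φ)
    {l : EuclideanSpace ℝ (Fin n)} (hl : l ∈ μ.support) (x : EuclideanSpace ℝ (Fin n)) :
    ∑' s, ν.mass s * φ (s - x) * 𝐞 (inner ℝ l s) = μ.mass l * 𝓕 φ 0 := by
  let ψ := 𝓕⁻ ((𝓕 (φ.compSubConstCLM ℂ x)).compSubConstCLM ℂ l)
  have hψ (s) : ψ s = φ (s - x) * 𝐞 (inner ℝ l s) := by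
    simp only [ψ, fourierInv_compSubConstCLM_apply, FourierTransform.fourierInv_fourier_eq,
      SchwartzMap.compSubConstCLM_apply, Circle.smul_def, smul_eq_mul, mul_comm]
  have hFψ (l') : 𝓕 ψ l' = 𝐞 (-inner ℝ x (l' - l)) * 𝓕 φ (l' - l) := by
    simp only [ψ, FourierTransform.fourier_fourierInv_eq, SchwartzMap.compSubConstCLM_apply,
      fourier_compSubConstCLM_apply, Circle.smul_def, smul_eq_mul]
  have hsingle (l') (hne : l' ≠ l) : μ.mass l' * 𝓕 ψ l' = 0 := by
    by_cases hl' : l' ∈ μ.support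
    · rw [hFψ, hφ _ (dist_eq_norm l' l ▸ hsep hl' hl hne), mul_zero, mul_zero]
    · rw [mass_eq_zero_of_notMem_support hl', zero_mul]
  calc ∑' s, ν.mass s * φ (s - x) * 𝐞 (inner ℝ l s)
    _ = ∑' s, ν.mass s * ψ s := by simp only [hψ, mul_assoc]
    _ = ∑' l', μ.mass l' * 𝓕 ψ l' := tsum_mass_mul_eq_tsum_mass_mul_fourier hF ψ
    _ = μ.mass l * 𝓕 ψ l := tsum_eq_single l hsingle
    _ = μ.mass l * 𝓕 φ 0 := by simp [hFψ]

theorem tsum_mass_mul_tsum_fourierChar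
    (hF : 𝓕 μ.toTemperedDistribution = ν.toTemperedDistribution)
    {d : ℝ} (hsep : μ.support.Pairwise fun l l' => d ≤ dist l l')
    {φ : 𝓢(EuclideanSpace ℝ (Fin n), ℂ)} (hφ : IsBandlimited d φ)
    {a : EuclideanSpace ℝ (Fin n) → ℂ} (ha : Summable fun l => ‖a l‖)
    (hsupp : Function.support a ⊆ μ.support) (x : EuclideanSpace ℝ (Fin n)) :
    ∑' s, ν.mass s * φ (s - x) * ∑' l, a l * 𝐞 (inner ℝ l s) =
      (∑' l, a l * μ.mass l) * 𝓕 φ 0 := by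
  have hsum : Summable (Function.uncurry fun s l : EuclideanSpace ℝ (Fin n) =>
      ν.mass s * φ (s - x) * (a l * 𝐞 (inner ℝ l s))) := by
    refine .of_norm (((ν.summable_mass_mul_comp_sub φ x).norm.mul_of_nonneg ha
      (fun _ => norm_nonneg _) (fun _ => norm_nonneg _)).congr fun p => ?_)
    simp only [Function.uncurry, norm_mul, Circle.norm_coe, mul_one]
  calc ∑' s, ν.mass s * φ (s - x) * ∑' l, a l * 𝐞 (inner ℝ l s)
    _ = ∑' s, ∑' l, ν.mass s * φ (s - x) * (a l * 𝐞 (inner ℝ l s)) := by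
        simp only [tsum_mul_left]
    _ = ∑' l, ∑' s, ν.mass s * φ (s - x) * (a l * 𝐞 (inner ℝ l s)) := hsum.tsum_comm.symm
    _ = ∑' l, a l * ∑' s, ν.mass s * φ (s - x) * 𝐞 (inner ℝ l s) := by
        simp only [mul_left_comm _ (a _), tsum_mul_left]
    _ = ∑' l, a l * μ.mass l * 𝓕 φ 0 := by
        refine tsum_congr fun l => ?_
        by_cases hl : l ∈ μ.support
        · rw [tsum_mass_mul_fourierChar hF hsep hφ hl x, mul_assoc]
        · rw [Function.notMem_support.mp (mt (@hsupp l) hl), zero_mul, zero_mul, zero_mul]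
    _ = (∑' l, a l * μ.mass l) * 𝓕 φ 0 := tsum_mul_right

theorem bumpAverage_eq_tsum_fourierChar
    (hF : 𝓕 μ.toTemperedDistribution = ν.toTemperedDistribution) (hν : ∀ s, 0 ≤ ν.mass s) (k : ℕ)
    (y : EuclideanSpace ℝ (Fin n)) :
    ν.bumpAverage k y = ∑' l, starRingEnd ℂ
      (μ.mass l * 𝓕 (shrinkingBump (EuclideanSpace ℝ (Fin n)) k) l) * 𝐞 (inner ℝ l y) := by
  have hreal : starRingEnd ℂ (ν.bumpAverage k y) = ν.bumpAverage k y :=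
    (tsum_nonneg fun s => mul_nonneg (hν s) (shrinkingBump_nonneg k _)).isSelfAdjoint
  rw [← hreal, bumpAverage, tsum_mass_mul_comp_sub hF, Complex.conj_tsum]
  refine tsum_congr fun l => ?_
  rw [map_mul, map_mul, map_mul, ← Circle.coe_inv_eq_conj, ← AddChar.map_neg_eq_inv, neg_neg,
    real_inner_comm]
  ring

theorem exists_bumpAverage_add_eq_tsum_fourierChar
    (hF : 𝓕 μ.toTemperedDistribution = ν.toTemperedDistribution) (hν : ∀ s, 0 ≤ ν.mass s) (k : ℕ)
    (h : EuclideanSpace ℝ (Fin n)) :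
    ∃ a : EuclideanSpace ℝ (Fin n) → ℂ, (Summable fun l => ‖a l‖) ∧
      Function.support a ⊆ μ.support ∧
      ∀ s, ν.bumpAverage k (s + h) = ∑' l, a l * 𝐞 (inner ℝ l s) := by
  let β := shrinkingBump (EuclideanSpace ℝ (Fin n)) k
  refine ⟨fun l => starRingEnd ℂ (μ.mass l * 𝓕 β l) * 𝐞 (inner ℝ l h),
    ?_, fun l hl => ?_, fun s => ?_⟩
  · simpa only [norm_mul, RCLike.norm_conj, Circle.norm_coe, mul_one] using
      (μ.summable_mass_mul (𝓕 β)).norm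
  · contrapose! hl
    simp [mass_eq_zero_of_notMem_support hl]
  · rw [bumpAverage_eq_tsum_fourierChar hF hν]
    refine tsum_congr fun l => ?_
    rw [add_comm, inner_add_right, AddChar.map_add_eq_mul, Circle.coe_mul, mul_assoc]

/-- The convolution of the correlation measure `∑ s, ν {s} ν {s + h} δ_s` with the reflection of a
test function `φ`. It detects the points `s` such that both `s` and `s + h` are atoms of `ν`. -/
noncomputable def correlation (ν : PurePointMeasure n) (h : EuclideanSpace ℝ (Fin n))
    (φ : 𝓢(EuclideanSpace ℝ (Fin n), ℂ)) (x : EuclideanSpace ℝ (Fin n)) : ℂ :=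
  ∑' s, ν.mass s * φ (s - x) * ν.mass (s + h)

theorem summable_correlation (hF : 𝓕 μ.toTemperedDistribution = ν.toTemperedDistribution)
    (hν : ∀ s, 0 ≤ ν.mass s) (h : EuclideanSpace ℝ (Fin n))
    (φ : 𝓢(EuclideanSpace ℝ (Fin n), ℂ)) (x : EuclideanSpace ℝ (Fin n)) :
    Summable fun s => ν.mass s * φ (s - x) * ν.mass (s + h) := by
  obtain ⟨M, hM⟩ := exists_norm_bumpAverage_le hF hν
  have hmass (y) : ‖ν.mass y‖ ≤ M := le_of_tendsto' (ν.tendsto_bumpAverage y).norm (hM · y)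
  refine .of_norm_bounded ((ν.summable_mass_mul_comp_sub φ x).norm.mul_right M) fun s => ?_
  rw [norm_mul _ (ν.mass (s + h))]
  exact mul_le_mul_of_nonneg_left (hmass _) (norm_nonneg _)

theorem tendsto_tsum_mass_mul_bumpAverage
    (hF : 𝓕 μ.toTemperedDistribution = ν.toTemperedDistribution)
    (hν : ∀ s, 0 ≤ ν.mass s) (h : EuclideanSpace ℝ (Fin n))
    (φ : 𝓢(EuclideanSpace ℝ (Fin n), ℂ)) (x : EuclideanSpace ℝ (Fin n)) :
    Tendsto (fun k => ∑' s, ν.mass s * φ (s - x) * ν.bumpAverage k (s + h)) atTop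
      (𝓝 (ν.correlation h φ x)) := by
  obtain ⟨M, hM⟩ := exists_norm_bumpAverage_le hF hν
  refine tendsto_tsum_of_dominated_convergence
    ((ν.summable_mass_mul_comp_sub φ x).norm.mul_right M)
    (fun s => (ν.tendsto_bumpAverage (s + h)).const_mul _) (.of_forall fun k s => ?_)
  rw [norm_mul _ (ν.bumpAverage k (s + h))]
  exact mul_le_mul_of_nonneg_left (hM k _) (norm_nonneg _)

theorem correlation_mul_fourier_zero
    (hF : 𝓕 μ.toTemperedDistribution = ν.toTemperedDistribution) (hν : ∀ s, 0 ≤ ν.mass s)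
    {d : ℝ} (hsep : μ.support.Pairwise fun l l' => d ≤ dist l l')
    {φ ψ : 𝓢(EuclideanSpace ℝ (Fin n), ℂ)} (hφ : IsBandlimited d φ) (hψ : IsBandlimited d ψ)
    (h x y : EuclideanSpace ℝ (Fin n)) :
    ν.correlation h φ x * 𝓕 ψ 0 = ν.correlation h ψ y * 𝓕 φ 0 := by
  choose a ha hsupp hav using exists_bumpAverage_add_eq_tsum_fourierChar hF hν (h := h)
  have hlim {χ : 𝓢(EuclideanSpace ℝ (Fin n), ℂ)} (hχ : IsBandlimited d χ) (z) :
      Tendsto (fun k => (∑' l, a k l * μ.mass l) * 𝓕 χ 0) atTop (𝓝 (ν.correlation h χ z)) :=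
    (tendsto_tsum_mass_mul_bumpAverage hF hν h χ z).congr fun k => by
      simp only [hav, tsum_mass_mul_tsum_fourierChar hF hsep hχ (ha k) (hsupp k)]
  exact tendsto_nhds_unique ((hlim hφ x).mul_const _)
    (((hlim hψ y).mul_const _).congr fun k => mul_right_comm _ _ _)

theorem correlation_pos (hF : 𝓕 μ.toTemperedDistribution = ν.toTemperedDistribution)
    (hν : ∀ s, 0 ≤ ν.mass s) {a b : EuclideanSpace ℝ (Fin n)} (ha : a ∈ ν.support)
    (hb : b ∈ ν.support) {φ : 𝓢(EuclideanSpace ℝ (Fin n), ℂ)} (hφ : ∀ x, 0 ≤ φ x)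
    (hφ0 : 0 < φ 0) : 0 < ν.correlation (b - a) φ a := by
  refine (summable_correlation hF hν (b - a) φ a).tsum_pos
    (fun s => mul_nonneg (mul_nonneg (hν s) (hφ _)) (hν _)) a ?_
  rw [sub_self, add_sub_cancel]
  exact mul_pos (mul_pos ((hν a).lt_of_ne' ha) hφ0) ((hν b).lt_of_ne' hb)

theorem correlation_nonpos (hν : ∀ s, 0 ≤ ν.mass s) {h x : EuclideanSpace ℝ (Fin n)} {r : ℝ}
    (hr : ∀ s ∈ ball x r, s ∈ ν.support → s + h ∉ ν.support)
    {φ : 𝓢(EuclideanSpace ℝ (Fin n), ℂ)} (hφ : ∀ y, r ≤ ‖y‖ → φ y ≤ 0) :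
    ν.correlation h φ x ≤ 0 := by
  refine tsum_nonpos fun s => ?_
  by_cases hs : s ∈ ball x r
  · by_cases hs' : s ∈ ν.support
    · rw [mass_eq_zero_of_notMem_support (hr s hs hs'), mul_zero]
    · rw [mass_eq_zero_of_notMem_support hs', zero_mul, zero_mul]
  · rw [mem_ball, not_lt, dist_eq_norm] at hs
    exact mul_nonpos_of_nonpos_of_nonneg (mul_nonpos_of_nonneg_of_nonpos (hν s) (hφ _ hs)) (hν _)

theorem exists_pos_forall_exists_mem_ball_add_sub_mem (n : ℕ) :
    ∃ R : ℝ, 0 < R ∧ ∀ μ ν : PurePointMeasure n,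
      𝓕 μ.toTemperedDistribution = ν.toTemperedDistribution → (∀ s, 0 ≤ ν.mass s) →
      ∀ d : ℝ, 0 < d → (μ.support.Pairwise fun l l' => d ≤ dist l l') →
      ∀ a ∈ ν.support, ∀ b ∈ ν.support,
      ∀ x, ∃ s ∈ ball x (R / d), s ∈ ν.support ∧ s + (b - a) ∈ ν.support := by
  obtain ⟨R, hR, hψ⟩ := exists_isBandlimited_nonpos_outside_ball (EuclideanSpace ℝ (Fin n))
  refine ⟨R, hR, fun μ ν hF hν d hd hsep a ha b hb x => ?_⟩
  by_contra! hdisj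
  obtain ⟨φ, hφ, hφ_nonneg, hφ0⟩ := exists_isBandlimited_nonneg (EuclideanSpace ℝ (Fin n)) hd
  obtain ⟨ψ, hψ, hψ_nonpos, hψ0⟩ := hψ d hd
  have hpos := mul_pos (correlation_pos hF hν ha hb hφ_nonneg hφ0) hψ0
  rw [correlation_mul_fourier_zero hF hν hsep hφ hψ (b - a) a x] at hpos
  exact hpos.not_ge (mul_nonpos_of_nonpos_of_nonneg (correlation_nonpos hν hdisj hψ_nonpos)
    (fourier_zero_nonneg hφ_nonneg))

end PurePointMeasure

theorem infinite_ball_inter_of_einfsep_eq_zero {V : Type*} [NormedAddCommGroup V] {S : Set V}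
    {r δ : ℝ} (hδ : 0 < δ) (hS : S.einfsep = 0)
    (hrec : ∀ a ∈ S, ∀ b ∈ S, ∀ x, ∃ s ∈ ball x r, s ∈ S ∧ s + (b - a) ∈ S) (x : V) :
    (ball x (r + δ) ∩ S).Infinite := by
  intro hfin
  obtain ⟨ε, hε, hsep⟩ := Set.einfsep_pos.mp hfin.einfsep_pos
  obtain ⟨a, ha, b, hb, hab, hlt⟩ := Set.einfsep_zero.mp hS (min ε (ENNReal.ofReal δ))
    (lt_min hε (ENNReal.ofReal_pos.mpr hδ))
  obtain ⟨hltε, hltδ⟩ := lt_min_iff.mp hlt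
  rw [edist_lt_ofReal] at hltδ
  obtain ⟨s, hs, hsS, hsS'⟩ := hrec a ha b hb x
  have hdist : dist s (s + (b - a)) = dist a b := by
    rw [dist_self_add_right, dist_comm, dist_eq_norm]
  have hball : s ∈ ball x (r + δ) := ball_subset_ball (by linarith) hs
  have hball' : s + (b - a) ∈ ball x (r + δ) := by
    have := dist_triangle_left (s + (b - a)) x s
    rw [mem_ball] at hs ⊢
    linarith
  have hne : s ≠ s + (b - a) := by simpa [eq_comm, sub_eq_zero] using hab
  have hle := hsep s ⟨hball, hsS⟩ _ ⟨hball', hsS'⟩ hne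
  rw [edist_dist, hdist, ← edist_dist] at hle
  exact hltε.not_ge hle

theorem isRelativelyDense_derivedSet {n : ℕ} {S : Set (EuclideanSpace ℝ (Fin n))} {r : ℝ}
    (hS : ∀ x, (ball x r ∩ S).Infinite) : IsRelativelyDense (derivedSet S) := by
  have hr : 0 < r := nonempty_ball.mp ((hS 0).nonempty.mono Set.inter_subset_left)
  refine ⟨r + 1, by positivity, fun x => ?_⟩
  obtain ⟨y, hy, hacc⟩ := (hS x).exists_accPt_of_subset_isCompact (isCompact_closedBall x r)
    (Set.inter_subset_left.trans ball_subset_closedBall)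
  exact ⟨y, closedBall_subset_ball (lt_add_one _) hy,
    hacc.mono (principal_mono.mpr Set.inter_subset_right)⟩

theorem PurePointMeasure.exists_pos_forall_infinite_ball_inter_support (n : ℕ) :
    ∃ C : ℝ, 0 < C ∧ ∀ μ ν : PurePointMeasure n,
      𝓕 μ.toTemperedDistribution = ν.toTemperedDistribution → (∀ s, 0 ≤ ν.mass s) →
      IsUniformlyDiscrete μ.support → ¬ IsUniformlyDiscrete ν.support →
      ∀ x, (ball x (C / μ.support.infsep) ∩ ν.support).Infinite := by
  obtain ⟨R, hR, hrec⟩ := exists_pos_forall_exists_mem_ball_add_sub_mem n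
  refine ⟨R + 1, by positivity, fun μ ν hF hν hμ hS x => ?_⟩
  have hS0 : ν.support.einfsep = 0 := nonpos_iff_eq_zero.mp (not_lt.mp hS)
  have hνS : ν.support.Nontrivial :=
    Set.nontrivial_of_einfsep_lt_top (hS0 ▸ ENNReal.zero_lt_top)
  have hd : 0 < μ.support.infsep :=
    Set.infsep_pos.mpr ⟨hμ, (nontrivial_support_of_nontrivial_support hF hνS).einfsep_lt_top⟩
  rw [add_div]
  exact infinite_ball_inter_of_einfsep_eq_zero (one_div_pos.mpr hd) hS0
    (hrec μ ν hF hν _ hd fun l hl l' hl' => Set.infsep_le_dist_of_mem hl hl') x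

/-- Here `μ.support` is `Λ`, `ν` is the Fourier transform of `μ`, `ν.support` is the spectrum `S`,
`derivedSet` is the set of accumulation points, and `Set.infsep` is the smallest distance `d(Λ)`
(a set `Λ` without two distinct points has `d(Λ) = ∞`, `infsep = 0`, and `C / d(Λ) = 0` for both).
-/
theorem mainTheorem2 (n : ℕ) :
    ∃ C : ℝ, 0 < C ∧ ∀ μ ν : PurePointMeasure n,
      IsPositiveDefiniteDistribution μ.toTemperedDistribution →
      𝓕 μ.toTemperedDistribution = ν.toTemperedDistribution →
      IsUniformlyDiscrete μ.support →
      (IsUniformlyDiscrete ν.support ∨ IsRelativelyDense (derivedSet ν.support)) ∧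
      (¬ IsUniformlyDiscrete ν.support →
        ∀ x : EuclideanSpace ℝ (Fin n),
          (Metric.ball x (C / μ.support.infsep) ∩ ν.support).Infinite) := by
  obtain ⟨C, hC, hinf⟩ := PurePointMeasure.exists_pos_forall_infinite_ball_inter_support n
  refine ⟨C, hC, fun μ ν hpd hF hΛ => ?_⟩
  have hν : ∀ s, 0 ≤ ν.mass s := PurePointMeasure.mass_nonneg_of_isPositive (hF ▸ hpd)
  exact ⟨or_iff_not_imp_left.mpr fun hS =>
    isRelativelyDense_derivedSet (hinf μ ν hF hν hΛ hS), hinf μ ν hF hν hΛ⟩
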